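/- **Theorem 4.** Let $f=(f_1,f_2)\in C^1(\mathbb R^2,\mathbb R^2)$ be such that $\dot x=f(x)$ is Hamiltonian and (s1) $f_1(\xi_1,\xi_2)=f_1(-\xi_1,\xi_2)$, (s2) $f_2(\xi_1,\xi_2)=-f_2(-\xi_1,\xi_2)$, (s3) $\partial f_1/\partial\xi_1=-\partial f_2/\partial\xi_2$ on $\mathbb R^2$. Let $g$ be an upper semicontinuous map from $\mathbb R\times\mathbb R^2\times[0,1]$ to the nonempty compact convex subsets of $\mathbb R^2$ such that for every bounded $B\subset\mathbb R^2$ there is $\mu_B\in L^\infty_{loc}(\mathbb R)$ with $\sup\{\|v\|:v\in g(t,x,\varepsilon)\}\le\mu_B(t)$ for all $t\in\mathbb R$, $x\in B$, $\varepsilon\in[0,1]$. Let $T>0$ and let $x_0=(x_{0,1},x_{0,2})$ be a nonconstant $T$-periodic solution of $\dot x=f(x)$ which is nondegenerate, i.e. the linearized system $\dot y=f'(x_0(t))y$ has a solution that is not $T$-periodic. For all sufficiently small $\varepsilon>0$ let $x_\varepsilon:\mathbb R\to\mathbb R^2$ be a $T$-periodic, locally absolutely continuous function satisfying $\dot x_\varepsilon(t)\in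 f(x_\varepsilon(t))+\varepsilon g(t,x_\varepsilon(t),\varepsilon)$ for almost all $t$, and assume $x_\varepsilon(t)\to x_0(t)$ as $\varepsilon\to0$ uniformly in $t\in[0,T]$. Let $y=(y_1,y_2)$ be the solution of the linearized system with $y(0)=(-\dot x_{0,2}(0),\dot x_{0,1}(0))$, and let $t_*\in[0,T]$ satisfy $\dot x_{0,2}(t_*)=0$. Then $y_1(t_*)\neq y_1(T+t_*)$, and, with $$M^\perp(t)=\Big\{\frac{\dot x_{0,1}(t_*)}{y_1(t_*)-y_1(T+t_*)}\int_{t-T}^t\det(-y(\tau),h(\tau))\,d\tau\;:\;h\in L^\infty([-T,T],\mathbb R^2),\ h(s)\in g(s,x_0(s),0)\text{ for a.a. }s\in[-T,T]\Big\},$$ there is a family $\{\Delta_\varepsilon\}_{\varepsilon>0}$ of real numbers with $\Delta_\varepsilon\to0$ as $\varepsilon\to0$ such that $$x_\varepsilon(t+\Delta_\varepsilon)-x_0(t)\in\frac1{\|\dot x_0(0)\|^2}\Big(\varepsilon M^\perp(t)\,y(t)+\big\langle(y_2(t),-y_1(t)),\,x_\varepsilon(t+\Delta_\varepsilon)-x_0(t)\big\rangle\,\dot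 x_0(t)\Big)+o(\varepsilon)$$ as $\varepsilon\to0$, uniformly in $t\in[0,T]$. -/

import Mathlib

open Set Filter Topology MeasureTheory

/-- The Euclidean plane; coordinates `x 0`, `x 1` are the first and second component. -/
abbrev Plane : Type := EuclideanSpace ℝ (Fin 2)

/-- The planar system `x' = f x` is Hamiltonian: `f = (∂H/∂ξ₂, -∂H/∂ξ₁)` for a function `H`. -/
def IsHamiltonianField (f : Plane → Plane) : Prop :=
  ∃ H : Plane → ℝ, Differentiable ℝ H ∧
    ∀ ξ : Plane, f ξ 0 = fderiv ℝ H ξ (EuclideanSpace.single 1 1) ∧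
      f ξ 1 = -fderiv ℝ H ξ (EuclideanSpace.single 0 1)

/-- The symmetry properties of the field `f = (f₁, f₂)`: `f₁` is even and `f₂` is odd with respect
to the first variable, and `∂f₁/∂ξ₁ = -∂f₂/∂ξ₂`. -/
structure IsSymmetricField (f : Plane → Plane) : Prop where
  even_fst : ∀ a b : ℝ, f !₂[a, b] 0 = f !₂[-a, b] 0
  odd_snd : ∀ a b : ℝ, f !₂[a, b] 1 = -f !₂[-a, b] 1
  deriv_fst : ∀ ξ : Plane, fderiv ℝ (fun p => f p 0) ξ (EuclideanSpace.single 0 1) =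
    -fderiv ℝ (fun p => f p 1) ξ (EuclideanSpace.single 1 1)

/-- A `T`-periodic cycle of `x' = f x`: a nonconstant `T`-periodic solution. -/
structure IsCycle (f : Plane → Plane) (T : ℝ) (x₀ : ℝ → Plane) : Prop where
  hasDerivAt : ∀ t, HasDerivAt x₀ (f (x₀ t)) t
  periodic : Function.Periodic x₀ T
  nonconstant : ∃ s t, x₀ s ≠ x₀ t

/-- `y` solves the system `y' = f'(x₀(t)) y` linearized along `x₀`. -/
def IsLinearizedSolution (f : Plane → Plane) (x₀ y : ℝ → Plane) : Prop :=
  ∀ t, HasDerivAt y (fderiv ℝ f (x₀ t) (y t)) t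

/-- The linearized system has a solution that is not `T`-periodic. -/
def IsNondegenerate (f : Plane → Plane) (T : ℝ) (x₀ : ℝ → Plane) : Prop :=
  ∃ u, IsLinearizedSolution f x₀ u ∧ ¬ Function.Periodic u T

/-- An upper semicontinuous map `g : ℝ × ℝ² × [0,1] → K(ℝ²)` whose values are nonempty compact
convex sets (only parameters `ε ∈ [0,1]` matter). -/
structure IsUSCPerturbation (g : ℝ → Plane → ℝ → Set Plane) : Prop where
  nonempty : ∀ t x, ∀ ε ∈ Icc (0 : ℝ) 1, (g t x ε).Nonempty
  isCompact : ∀ t x, ∀ ε ∈ Icc (0 : ℝ) 1, IsCompact (g t x ε)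
  convex : ∀ t x, ∀ ε ∈ Icc (0 : ℝ) 1, Convex ℝ (g t x ε)
  usc : UpperHemicontinuousOn (fun p : ℝ × Plane × ℝ => g p.1 p.2.1 p.2.2)
    {p | p.2.2 ∈ Icc (0 : ℝ) 1}

/-- On each bounded set `B` of states, `g` is bounded by some `μ ∈ L^∞_loc(ℝ)`. -/
def IsLocallyDominated (g : ℝ → Plane → ℝ → Set Plane) : Prop :=
  ∀ B : Set Plane, Bornology.IsBounded B → ∃ μ : ℝ → ℝ,
    (∀ K : Set ℝ, IsCompact K → MemLp μ ⊤ (volume.restrict K)) ∧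
    ∀ t, ∀ x ∈ B, ∀ ε ∈ Icc (0 : ℝ) 1, ∀ v ∈ g t x ε, ‖v‖ ≤ μ t

/-- `x` is a solution on `ℝ` of the differential inclusion `x' ∈ f(x) + ε g(t, x, ε)`: it is
absolutely continuous on every compact interval and the inclusion holds almost everywhere. -/
structure IsInclusionSolution (f : Plane → Plane) (g : ℝ → Plane → ℝ → Set Plane) (ε : ℝ)
    (x : ℝ → Plane) : Prop where
  absolutelyContinuous : ∀ a b : ℝ, AbsolutelyContinuousOnInterval x a b
  inclusion : ∀ᵐ t : ℝ, ∃ v ∈ g t (x t) ε, HasDerivAt x (f (x t) + ε • v) t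

/-- The set `M^⊥(t)` of the numbers
`ẋ₀₁(t⋆) / (y₁(t⋆) - y₁(T + t⋆)) * ∫_{t-T}^t det(-y(τ), h(τ)) dτ`, where `h ∈ L^∞([-T,T], ℝ²)` is a
selection of `g(·, x₀(·), 0)`. -/
def MPerp (g : ℝ → Plane → ℝ → Set Plane) (T : ℝ) (x₀ y : ℝ → Plane) (tstar t : ℝ) : Set ℝ :=
  {m | ∃ h : ℝ → Plane, MemLp h ⊤ (volume.restrict (Icc (-T) T)) ∧
    (∀ᵐ s ∂(volume.restrict (Icc (-T) T)), h s ∈ g s (x₀ s) 0) ∧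
    m = deriv x₀ tstar 0 / (y tstar 0 - y (T + tstar) 0) *
      ∫ τ in (t - T)..t, Matrix.det !![-(y τ 0), h τ 0; -(y τ 1), h τ 1]}

/-! Write `p` for the velocity of the cycle and `z` for the difference between the shifted perturbed
solution and the cycle. Then `z` satisfies the linearized equation with forcing `ρ`, the sum of a
Taylor remainder and `ε • w`, where `w` takes values in the perturbation. The matrix `f'(x₀)` has
trace zero, so the determinant `wedge` of two linearized solutions is constant, and for a linearized
solution `q` the function `wedge q z` has derivative `wedge q ρ`. With `N = wedge p y = ‖p 0‖ ^ 2`,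
Cramer's rule gives `N z = (wedge z y) p + (wedge p z) y`. The first coefficient is exactly the
inner product in the statement, so only the second one has to be expanded.

Nondegeneracy makes the monodromy a shear `y (t + T) = y t + c p t` with `c ≠ 0`
(`IsCycle.exists_shear`). Integrating over one period, with `z` periodic, yields `c * wedge (p t) (z
t) = ∫ wedge y ρ` over `[t - T, t]` (`shear_mul_wedge_eq_integral`). The prefactor of `MPerp` equals
`-c⁻¹`.

The phase is chosen so that `wedge (z 0) (y 0) = 0` (`exists_phase`); this gives `‖z‖ = O(ε)`
(`norm_le_of_forced_linearized`), so the Taylor remainder is `o(ε)`. Finally `w` is replaced by its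
nearest-point projection onto `g s (x₀ s) 0`, a measurable selection
(`exists_measurable_nearest_selection`); the error tends to zero in `L¹`
(`tendsto_integral_infDist`). -/

/-- The determinant of the matrix with columns `a` and `b`. -/
def wedge (a b : Plane) : ℝ := a 0 * b 1 - a 1 * b 0

lemma wedge_sub_left (a b c : Plane) : wedge (a - b) c = wedge a c - wedge b c := by
  simp [wedge]; ring

lemma wedge_add_right (a b c : Plane) : wedge a (b + c) = wedge a b + wedge a c := by
  simp [wedge]; ring

lemma wedge_sub_right (a b c : Plane) : wedge a (b - c) = wedge a b - wedge a c := by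
  simp [wedge]; ring

lemma wedge_smul_left (k : ℝ) (a b : Plane) : wedge (k • a) b = k * wedge a b := by
  simp [wedge]; ring

lemma wedge_smul_right (k : ℝ) (a b : Plane) : wedge a (k • b) = k * wedge a b := by
  simp [wedge]; ring

lemma wedge_swap (a b : Plane) : wedge a b = -wedge b a := by
  simp [wedge]; ring

/-- Cramer's rule, kept free of division so that no independence is needed. -/
lemma wedge_cramer (a b z : Plane) : wedge a b • z = wedge z b • a + wedge a z • b := by
  ext i
  fin_cases i <;> simp [wedge] <;> ring

lemma abs_wedge_le (a b : Plane) : |wedge a b| ≤ ‖a‖ * ‖b‖ := by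
  apply abs_le_of_sq_le_sq _ (by positivity)
  rw [mul_pow, EuclideanSpace.norm_sq_eq, EuclideanSpace.norm_sq_eq]
  simp only [Fin.sum_univ_two, Real.norm_eq_abs, sq_abs, wedge]
  nlinarith [sq_nonneg (a 0 * b 0 + a 1 * b 1)]

lemma Continuous.wedge {X : Type*} [TopologicalSpace X] {u v : X → Plane} (hu : Continuous u)
    (hv : Continuous v) : Continuous fun t => wedge (u t) (v t) := by
  unfold _root_.wedge
  fun_prop

lemma HasDerivAt.plane_apply {u : ℝ → Plane} {u' : Plane} {t : ℝ} (hu : HasDerivAt u u' t)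
    (i : Fin 2) : HasDerivAt (fun s => u s i) (u' i) t :=
  (EuclideanSpace.proj (𝕜 := ℝ) i).hasFDerivAt.comp_hasDerivAt t hu

lemma HasDerivAt.wedge {u v : ℝ → Plane} {u' v' : Plane} {t : ℝ} (hu : HasDerivAt u u' t)
    (hv : HasDerivAt v v' t) :
    HasDerivAt (fun s => wedge (u s) (v s)) (wedge u' (v t) + wedge (u t) v') t := by
  have h := ((hu.plane_apply 0).mul (hv.plane_apply 1)).sub
    ((hu.plane_apply 1).mul (hv.plane_apply 0))
  convert! h using 1
  simp [_root_.wedge]; ring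

lemma fderiv_plane_apply {f : Plane → Plane} {ξ : Plane} (hf : DifferentiableAt ℝ f ξ) (i : Fin 2)
    (v : Plane) : fderiv ℝ (fun p => f p i) ξ v = fderiv ℝ f ξ v i := by
  have h := (EuclideanSpace.proj (𝕜 := ℝ) i).hasFDerivAt.comp ξ hf.hasFDerivAt
  have h2 : HasFDerivAt (fun p => f p i) _ ξ := h
  rw [h2.fderiv]
  rfl

lemma map_plane_eq (L : Plane →L[ℝ] Plane) (v : Plane) :
    L v = v 0 • L (EuclideanSpace.single 0 1) + v 1 • L (EuclideanSpace.single 1 1) := by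
  rw [← map_smul, ← map_smul, ← map_add]
  congr 1
  ext i
  fin_cases i <;> simp

/-- A traceless linear map is infinitesimally area preserving. -/
lemma IsSymmetricField.wedge_fderiv {f : Plane → Plane} (hs : IsSymmetricField f)
    (hf : Differentiable ℝ f) (ξ a b : Plane) :
    wedge (fderiv ℝ f ξ a) b + wedge a (fderiv ℝ f ξ b) = 0 := by
  have h := hs.deriv_fst ξ
  rw [fderiv_plane_apply (hf ξ), fderiv_plane_apply (hf ξ)] at h
  rw [map_plane_eq _ a, map_plane_eq _ b]
  simp only [wedge, PiLp.add_apply, PiLp.smul_apply, smul_eq_mul, h]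
  ring

/-! ### The linearized flow and its monodromy -/

section Linearized

variable {f : Plane → Plane} {T : ℝ} {x₀ : ℝ → Plane}

lemma IsLinearizedSolution.continuous {u : ℝ → Plane} (hu : IsLinearizedSolution f x₀ u) :
    Continuous u :=
  continuous_iff_continuousAt.2 fun t => (hu t).continuousAt

/-- The Wronskian of two solutions of the linearized system is constant. -/
lemma IsLinearizedSolution.wedge_eq {u v : ℝ → Plane} (hu : IsLinearizedSolution f x₀ u)
    (hv : IsLinearizedSolution f x₀ v) (hs : IsSymmetricField f) (hf : Differentiable ℝ f)
    (s t : ℝ) : wedge (u s) (v s) = wedge (u t) (v t) := by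
  have h : ∀ t, HasDerivAt (fun s => wedge (u s) (v s)) 0 t := fun t => by
    simpa only [hs.wedge_fderiv hf] using (hu t).wedge (hv t)
  exact is_const_of_deriv_eq_zero (fun t => (h t).differentiableAt) (fun t => (h t).deriv) s t

lemma IsLinearizedSolution.sub {u v : ℝ → Plane} (hu : IsLinearizedSolution f x₀ u)
    (hv : IsLinearizedSolution f x₀ v) : IsLinearizedSolution f x₀ fun t => u t - v t :=
  fun t => by simpa only [map_sub] using (hu t).fun_sub (hv t)

namespace IsCycle

lemma deriv_eq (h : IsCycle f T x₀) : deriv x₀ = fun t => f (x₀ t) :=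
  funext fun t => (h.hasDerivAt t).deriv

lemma continuous (h : IsCycle f T x₀) : Continuous x₀ :=
  continuous_iff_continuousAt.2 fun t => (h.hasDerivAt t).continuousAt

lemma linearized_shift (h : IsCycle f T x₀) {u : ℝ → Plane} (hu : IsLinearizedSolution f x₀ u) :
    IsLinearizedSolution f x₀ fun t => u (t + T) := fun t => by
  simpa only [h.periodic t] using (hu (t + T)).comp_add_const t T

lemma deriv_periodic (h : IsCycle f T x₀) : Function.Periodic (deriv x₀) T := fun t => by
  simp only [h.deriv_eq, h.periodic t]

lemma linearized_deriv (h : IsCycle f T x₀) (hf : Differentiable ℝ f) :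
    IsLinearizedSolution f x₀ (deriv x₀) := by
  intro t
  rw [h.deriv_eq]
  exact (hf (x₀ t)).hasFDerivAt.comp_hasDerivAt t (h.hasDerivAt t)

/-- The velocity solves a linear equation, so one zero would make it vanish identically and the
cycle constant. Periodicity supplies the uniform Lipschitz constant for global uniqueness. -/
lemma deriv_ne_zero (h : IsCycle f T x₀) (hT : 0 < T) (hf : ContDiff ℝ 1 f) (t₀ : ℝ) :
    deriv x₀ t₀ ≠ 0 := by
  intro h0
  have hc : Continuous fun t => fderiv ℝ f (x₀ t) :=
    (hf.continuous_fderiv one_ne_zero).comp h.continuous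
  have hp : Function.Periodic (fun t => fderiv ℝ f (x₀ t)) T := fun t => by
    simp only [h.periodic t]
  obtain ⟨K, hK⟩ := (hp.isBounded_of_continuous hT.ne' hc).exists_norm_le
  have hfd := hf.differentiable one_ne_zero
  have hz : deriv x₀ = fun _ => 0 := by
    refine ODE_solution_unique_univ (K := K.toNNReal) (v := fun t v => fderiv ℝ f (x₀ t) v)
      (s := fun _ => univ) (t₀ := t₀) ?_ ?_ ?_ h0
    · intro t
      refine ((fderiv ℝ f (x₀ t)).lipschitz.weaken ?_).lipschitzOnWith
      rw [← NNReal.coe_le_coe, coe_nnnorm]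
      exact (hK _ (mem_range_self t)).trans (Real.le_coe_toNNReal K)
    · exact fun t => ⟨h.linearized_deriv hfd t, mem_univ _⟩
    · exact fun t => ⟨by simpa using hasDerivAt_const t (0 : Plane), mem_univ _⟩
  obtain ⟨s, t, hst⟩ := h.nonconstant
  exact hst (is_const_of_deriv_eq_zero (fun t => (h.hasDerivAt t).differentiableAt)
    (fun t => congrFun hz t) s t)

/-- The monodromy operator is a nontrivial shear along the tangent of a nondegenerate cycle. -/
lemma exists_shear (h : IsCycle f T x₀) (hs : IsSymmetricField f) (hf : Differentiable ℝ f)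
    (hnd : IsNondegenerate f T x₀) {y : ℝ → Plane} (hy : IsLinearizedSolution f x₀ y)
    (hN : wedge (deriv x₀ 0) (y 0) ≠ 0) :
    ∃ c : ℝ, c ≠ 0 ∧ ∀ t, y (t + T) = y t + c • deriv x₀ t := by
  have hp := h.linearized_deriv hf
  have hpT := h.deriv_periodic
  set p := deriv x₀ with hpdef
  set N := wedge (p 0) (y 0) with hNdef
  have key : ∀ u, IsLinearizedSolution f x₀ u → ∀ t,
      u t = N⁻¹ • (wedge (u 0) (y 0) • p t + wedge (p 0) (u 0) • y t) := by
    intro u hu t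
    rw [eq_inv_smul_iff₀ hN, hNdef, hp.wedge_eq hy hs hf 0 t, hu.wedge_eq hy hs hf 0 t,
      hp.wedge_eq hu hs hf 0 t]
    exact wedge_cramer _ _ _
  have hd := (h.linearized_shift hy).sub hy
  -- Constancy of the Wronskian and periodicity of `p` leave the increment of `y` over a period no
  -- component along `y`.
  have hpd : wedge (p 0) (y (0 + T) - y 0) = 0 := by
    have h1 := hp.wedge_eq hy hs hf (0 + T) 0
    rw [hpT 0] at h1
    rw [wedge_sub_right, h1, sub_self]
  have hshift : ∀ t, y (t + T) = y t + (N⁻¹ * wedge (y (0 + T) - y 0) (y 0)) • p t := by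
    intro t
    have h1 := key _ hd t
    simp only [hpd, zero_smul, add_zero, smul_smul] at h1
    rw [← h1]; abel
  refine ⟨_, fun hc => ?_, hshift⟩
  -- With `c = 0` both basis solutions, hence all solutions, would be periodic.
  obtain ⟨u, hu, hnp⟩ := hnd
  refine hnp fun t => ?_
  rw [key u hu (t + T), key u hu t, hshift t, hc, zero_smul, add_zero, hpT t]

end IsCycle

end Linearized

/-! ### Absolutely continuous solutions and the Lagrange identity -/

section AbsolutelyContinuous

lemma AbsolutelyContinuousOnInterval.plane_apply {z : ℝ → Plane} {a b : ℝ}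
    (hz : AbsolutelyContinuousOnInterval z a b) (i : Fin 2) :
    AbsolutelyContinuousOnInterval (fun t => z t i) a b := by
  unfold AbsolutelyContinuousOnInterval at hz ⊢
  refine squeeze_zero (fun E => Finset.sum_nonneg fun _ _ => dist_nonneg)
    (fun E => Finset.sum_le_sum fun j _ => ?_) hz
  rw [Real.dist_eq, dist_eq_norm, ← Real.norm_eq_abs]
  exact PiLp.norm_apply_le (z (E.2 j).1 - z (E.2 j).2) i

lemma AbsolutelyContinuousOnInterval.wedge {u v : ℝ → Plane} {a b : ℝ}
    (hu : AbsolutelyContinuousOnInterval u a b) (hv : AbsolutelyContinuousOnInterval v a b) :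
    AbsolutelyContinuousOnInterval (fun t => wedge (u t) (v t)) a b :=
  ((hu.plane_apply 0).mul (hv.plane_apply 1)).sub ((hu.plane_apply 1).mul (hv.plane_apply 0))

lemma AbsolutelyContinuousOnInterval.comp_add_const {X : Type*} [PseudoMetricSpace X]
    {u : ℝ → X} (hu : ∀ a b, AbsolutelyContinuousOnInterval u a b) (d a b : ℝ) :
    AbsolutelyContinuousOnInterval (fun t => u (t + d)) a b := by
  have h := hu (a + d) (b + d)
  rw [absolutelyContinuousOnInterval_iff] at h ⊢
  intro ε hε
  obtain ⟨δ, hδ, H⟩ := h ε hε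
  refine ⟨δ, hδ, fun E hE hEδ => ?_⟩
  refine H (E.1, fun i => ((E.2 i).1 + d, (E.2 i).2 + d)) ⟨fun i hi => ?_, ?_⟩ ?_
  · have h1 := hE.1 i hi
    rw [← image_add_const_uIcc]
    exact ⟨mem_image_of_mem _ h1.1, mem_image_of_mem _ h1.2⟩
  · intro i hi j hj hij
    have h1 := hE.2 hi hj hij
    simp only [Function.onFun, uIoc, min_add_add_right, max_add_add_right,
      ← image_add_const_Ioc] at h1 ⊢
    exact (disjoint_image_iff (add_left_injective d)).2 h1
  · simpa only [dist_add_right] using hEδ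

lemma IsLinearizedSolution.contDiff {f : Plane → Plane} {x₀ q : ℝ → Plane}
    (hq : IsLinearizedSolution f x₀ q) (hf : ContDiff ℝ 1 f) (hx₀ : Continuous x₀) :
    ContDiff ℝ 1 q := by
  refine contDiff_one_iff_deriv.2 ⟨fun t => (hq t).differentiableAt, ?_⟩
  rw [show deriv q = fun t => fderiv ℝ f (x₀ t) (q t) from funext fun t => (hq t).deriv]
  exact ((hf.continuous_fderiv one_ne_zero).comp hx₀).clm_apply hq.continuous

/-- The Lagrange identity for an absolutely continuous solution of a forced linear system. -/
lemma IsLinearizedSolution.wedge_sub_eq_integral {f : Plane → Plane} {x₀ q z ρ : ℝ → Plane}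
    (hq : IsLinearizedSolution f x₀ q) (hf : ContDiff ℝ 1 f) (hs : IsSymmetricField f)
    (hx₀ : Continuous x₀) {a b : ℝ} (hz : AbsolutelyContinuousOnInterval z a b)
    (hzd : ∀ᵐ t, HasDerivAt z (fderiv ℝ f (x₀ t) (z t) + ρ t) t) :
    wedge (q b) (z b) - wedge (q a) (z a) = ∫ t in a..b, wedge (q t) (ρ t) := by
  have hqa : AbsolutelyContinuousOnInterval q a b :=
    (hq.contDiff hf hx₀).contDiffOn.absolutelyContinuousOnInterval
  rw [← (hqa.wedge hz).integral_deriv_eq_sub]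
  refine intervalIntegral.integral_congr_ae ?_
  filter_upwards [hzd] with t ht _
  rw [((hq t).wedge ht).deriv, wedge_add_right, ← add_assoc,
    hs.wedge_fderiv (hf.differentiable one_ne_zero), zero_add]

end AbsolutelyContinuous

/-! ### Measurable nearest-point selections -/

section Selection

variable {G : ℝ → Set Plane}

/-- Compactness leaves room to enlarge a ball that misses `G s ∩ C`; upper hemicontinuity and the
triangle inequality then carry the miss to nearby parameters. Measurability of the distance and of
the selection both reduce to this closed set. -/
lemma isClosed_setOf_inter_closedBall_nonempty {α : Type*} [TopologicalSpace α]
    {G : α → Set Plane} (hc : ∀ s, IsCompact (G s)) (hG : UpperHemicontinuousOn G univ)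
    {C : Set Plane} (hC : IsClosed C) :
    IsClosed {p : α × Plane × ℝ | (G p.1 ∩ (C ∩ Metric.closedBall p.2.1 p.2.2)).Nonempty} := by
  rw [← isOpen_compl_iff, isOpen_iff_mem_nhds]
  rintro ⟨s, w, r⟩ hp
  simp only [mem_compl_iff, mem_ofPred_eq, not_nonempty_iff_eq_empty] at hp
  obtain ⟨r', hr', hd⟩ : ∃ r' > r, G s ∩ (C ∩ Metric.closedBall w r') = ∅ := by
    rcases (G s ∩ C).eq_empty_or_nonempty with he | hne
    · exact ⟨r + 1, by linarith, by rw [← inter_assoc, he, empty_inter]⟩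
    · obtain ⟨v, hv, hvd⟩ := ((hc s).inter_right hC).exists_infDist_eq_dist hne w
      have hvr : r < dist w v := by
        by_contra! hle
        have : v ∈ G s ∩ (C ∩ Metric.closedBall w r) :=
          ⟨hv.1, hv.2, by rwa [Metric.mem_closedBall, dist_comm]⟩
        simp [hp] at this
      refine ⟨(r + dist w v) / 2, by linarith, ?_⟩
      by_contra hne'
      obtain ⟨u, hu, huC, hub⟩ := nonempty_iff_ne_empty.2 hne'
      have h1 := Metric.infDist_le_dist_of_mem (x := w) (show u ∈ G s ∩ C from ⟨hu, huC⟩)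
      rw [Metric.mem_closedBall, dist_comm] at hub
      linarith
  have hev := hG.forall_isOpen s (mem_univ s) (C ∩ Metric.closedBall w r')ᶜ
    (hC.inter Metric.isClosed_closedBall).isOpen_compl
    (disjoint_iff_inter_eq_empty.2 hd).subset_compl_right
  rw [nhdsWithin_univ] at hev
  have hev2 : ∀ᶠ p : α × Plane × ℝ in 𝓝 (s, w, r), dist p.2.1 w + p.2.2 < r' := by
    refine ContinuousAt.eventually_lt (by fun_prop) continuousAt_const ?_
    simpa using hr'
  filter_upwards [continuousAt_fst.eventually hev, hev2] with p hp1 hp2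
  rintro ⟨u, hu, huC, hub⟩
  refine hp1 hu ⟨huC, ?_⟩
  rw [Metric.mem_closedBall] at hub ⊢
  linarith [dist_triangle u p.2.1 w]

/-- By the parallelogram law, the midpoint of two distinct nearest points would be strictly nearer.
-/
lemma Convex.eq_of_dist_le_infDist {E : Type*} [NormedAddCommGroup E] [InnerProductSpace ℝ E]
    {K : Set E} (hK : Convex ℝ K) {w u v : E} (hu : u ∈ K)
    (hv : v ∈ K) (hwu : dist w u ≤ Metric.infDist w K) (hwv : dist w v ≤ Metric.infDist w K) :
    u = v := by
  have hm : (1 / 2 : ℝ) • u + (1 / 2 : ℝ) • v ∈ K :=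
    hK hu hv (by norm_num) (by norm_num) (by norm_num)
  have h1 := Metric.infDist_le_dist_of_mem (x := w) hm
  have h2 := parallelogram_law_with_norm ℝ (w - u) (w - v)
  rw [dist_eq_norm] at hwu hwv h1
  have h3 : w - ((1 / 2 : ℝ) • u + (1 / 2 : ℝ) • v) = (1 / 2 : ℝ) • (w - u + (w - v)) := by
    module
  rw [h3, norm_smul, Real.norm_of_nonneg (by norm_num)] at h1
  have h4 : w - u - (w - v) = v - u := by abel
  rw [h4] at h2
  have h5 : ‖v - u‖ = 0 := by
    have := Metric.infDist_nonneg (x := w) (s := K)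
    nlinarith [norm_nonneg (v - u), norm_nonneg (w - u), norm_nonneg (w - v),
      norm_nonneg (w - u + (w - v))]
  exact (sub_eq_zero.1 (norm_eq_zero.1 h5)).symm

lemma measurable_infDist_of_upperHemicontinuousOn (hne : ∀ s, (G s).Nonempty)
    (hc : ∀ s, IsCompact (G s)) (hG : UpperHemicontinuousOn G univ) {w : ℝ → Plane}
    (hw : Measurable w) : Measurable fun s => Metric.infDist (w s) (G s) := by
  refine measurable_of_Iic fun r => ?_
  have h := (isClosed_setOf_inter_closedBall_nonempty hc hG isClosed_univ).measurableSet.preimage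
    (measurable_id.prodMk (hw.prodMk measurable_const) : Measurable fun s => (s, w s, r))
  convert! h using 1
  ext s
  simp only [mem_preimage, mem_Iic, mem_ofPred_eq, univ_inter]
  constructor
  · intro hs
    obtain ⟨v, hv, hvd⟩ := (hc s).exists_infDist_eq_dist (hne s) (w s)
    exact ⟨v, hv, by rw [Metric.mem_closedBall, dist_comm, ← hvd]; exact hs⟩
  · rintro ⟨v, hv, hvd⟩
    rw [Metric.mem_closedBall, dist_comm] at hvd
    exact (Metric.infDist_le_dist_of_mem hv).trans hvd

/-- The nearest point selection of an upper hemicontinuous convex-valued map is measurable. -/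
lemma exists_measurable_nearest_selection (hne : ∀ s, (G s).Nonempty)
    (hc : ∀ s, IsCompact (G s)) (hconv : ∀ s, Convex ℝ (G s)) (hG : UpperHemicontinuousOn G univ)
    {w : ℝ → Plane} (hw : Measurable w) :
    ∃ h : ℝ → Plane, Measurable h ∧
      ∀ s, h s ∈ G s ∧ ‖w s - h s‖ = Metric.infDist (w s) (G s) := by
  choose h hmem hdist using fun s => (hc s).exists_infDist_eq_dist (hne s) (w s)
  refine ⟨h, measurable_of_isClosed fun C hC => ?_,
    fun s => ⟨hmem s, by rw [hdist, dist_eq_norm]⟩⟩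
  -- As the nearest point is unique, `h s ∈ C` exactly when `C` meets `G s` within the minimal
  -- distance.
  have hm := (isClosed_setOf_inter_closedBall_nonempty hc hG hC).measurableSet.preimage
    (measurable_id.prodMk (hw.prodMk (measurable_infDist_of_upperHemicontinuousOn hne hc hG hw)) :
      Measurable fun s => (s, w s, Metric.infDist (w s) (G s)))
  convert! hm using 1
  ext s
  simp only [mem_preimage, mem_ofPred_eq]
  constructor
  · exact fun hs => ⟨h s, hmem s, hs, by rw [Metric.mem_closedBall, dist_comm, hdist]⟩
  · rintro ⟨v, hv, hvC, hvd⟩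
    rw [Metric.mem_closedBall, dist_comm] at hvd
    rwa [(hconv s).eq_of_dist_le_infDist (hmem s) hv (hdist s).ge hvd]

lemma UpperHemicontinuousOn.eventually_infDist_lt {α E : Type*} [TopologicalSpace α]
    [PseudoMetricSpace E] {F : α → Set E} {S : Set α} (hF : UpperHemicontinuousOn F S) {p : α}
    (hp : p ∈ S) (hne : (F p).Nonempty) {η : ℝ} (hη : 0 < η) :
    ∀ᶠ p' in 𝓝[S] p, ∀ v ∈ F p', Metric.infDist v (F p) < η := by
  filter_upwards [hF.forall_isOpen p hp _ Metric.isOpen_thickening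
    (Metric.self_subset_thickening hη (F p))] with p' hp' v hv
  exact (Metric.mem_thickening_iff_infDist_lt hne).1 (hp' hv)

end Selection

/-! ### Choice of the phase -/

/-- Taking a witness whose absolute value is within `ε` of the infimum makes one choice serve every
`δ` at once. -/
lemma exists_tendsto_nhds_zero_of_eventually {P : ℝ → ℝ → Prop}
    (h : ∀ δ > (0 : ℝ), ∀ᶠ ε in 𝓝[>] (0 : ℝ), ∃ d, |d| ≤ δ ∧ P ε d) :
    ∃ Δ : ℝ → ℝ, Tendsto Δ (𝓝[>] 0) (𝓝 0) ∧ ∀ᶠ ε in 𝓝[>] (0 : ℝ), P ε (Δ ε) := by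
  have hch : ∀ ε : ℝ, ∃ d, (0 < ε → (∃ d', P ε d') →
      P ε d ∧ ∀ d', P ε d' → |d| ≤ |d'| + ε) := by
    intro ε
    by_cases hε : 0 < ε ∧ ∃ d', P ε d'
    · obtain ⟨hε, d₀, hd₀⟩ := hε
      set A := (fun d => |d|) '' {d | P ε d}
      have hb : BddBelow A := ⟨0, by rintro _ ⟨d, -, rfl⟩; exact abs_nonneg d⟩
      obtain ⟨_, ⟨d, hd, rfl⟩, hlt⟩ :=
        exists_lt_of_csInf_lt (⟨_, mem_image_of_mem _ hd₀⟩ : A.Nonempty)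
          (lt_add_of_pos_right (sInf A) hε)
      exact ⟨d, fun _ _ => ⟨hd, fun d' hd' => hlt.le.trans
        (by gcongr; exact csInf_le hb (mem_image_of_mem _ hd'))⟩⟩
    · exact ⟨0, fun h1 h2 => absurd ⟨h1, h2⟩ hε⟩
  choose Δ hΔ using hch
  refine ⟨Δ, ?_, ?_⟩
  · rw [Metric.tendsto_nhds]
    intro η hη
    filter_upwards [h (η / 2) (by positivity), self_mem_nhdsWithin,
      nhdsWithin_le_nhds (Iio_mem_nhds (half_pos hη))] with ε ⟨d, hd, hPd⟩ hε hεη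
    have h1 := (hΔ ε hε ⟨d, hPd⟩).2 d hPd
    rw [dist_zero_right, Real.norm_eq_abs]
    simp only [mem_Iio] at hεη
    linarith
  · filter_upwards [h 1 one_pos, self_mem_nhdsWithin] with ε ⟨d, _, hPd⟩ hε
    exact (hΔ ε hε ⟨d, hPd⟩).1

/-- By transversality the limit function `φ` changes sign across zero. Convergence at two endpoints
preserves the signs, and the intermediate value theorem gives a zero between them. -/
lemma exists_phase {x : ℝ → ℝ → Plane} {x₀ : ℝ → Plane} {b : Plane}
    (hc : ∀ᶠ ε in 𝓝[>] (0 : ℝ), Continuous (x ε))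
    (hconv : ∀ t, Tendsto (fun ε => x ε t) (𝓝[>] 0) (𝓝 (x₀ t))) (hd : DifferentiableAt ℝ x₀ 0)
    (hpos : 0 < wedge (deriv x₀ 0) b) :
    ∃ Δ : ℝ → ℝ, Tendsto Δ (𝓝[>] 0) (𝓝 0) ∧
      ∀ᶠ ε in 𝓝[>] (0 : ℝ), wedge (x ε (Δ ε) - x₀ 0) b = 0 := by
  refine exists_tendsto_nhds_zero_of_eventually (P := fun ε d => wedge (x ε d - x₀ 0) b = 0) ?_
  intro δ hδ
  set φ : ℝ → ℝ := fun d => wedge (x₀ d - x₀ 0) b with hφ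
  have hφd : HasDerivAt φ (wedge (deriv x₀ 0) b) 0 := by
    have h1 := (hd.hasDerivAt.sub_const (x₀ 0)).wedge (hasDerivAt_const (0 : ℝ) b)
    simpa [φ, wedge] using h1
  have hsign := eventually_nhdsWithin_sign_eq_of_deriv_pos (f := φ) (x₀ := 0)
    (by rw [hφd.deriv]; exact hpos) (by simp [hφ, wedge])
  rw [Metric.eventually_nhds_iff] at hsign
  obtain ⟨r, hr, hsign⟩ := hsign
  set e := min (r / 2) δ with he
  have he0 : 0 < e := lt_min (by positivity) hδ
  have her : e < r := (min_le_left _ _).trans_lt (by linarith)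
  have hp : 0 < φ e := by
    have := hsign (y := e) (by rwa [dist_zero_right, Real.norm_of_nonneg he0.le])
    rwa [sub_zero, sign_pos he0, sign_eq_one_iff] at this
  have hn : φ (-e) < 0 := by
    have := hsign (y := -e) (by rwa [dist_zero_right, norm_neg, Real.norm_of_nonneg he0.le])
    rwa [sub_zero, sign_neg (neg_lt_zero.2 he0), sign_eq_neg_one_iff] at this
  have hcw : Continuous fun v => wedge (v - x₀ 0) b :=
    (continuous_id.sub continuous_const).wedge continuous_const
  have hlim : ∀ t, Tendsto (fun ε => wedge (x ε t - x₀ 0) b) (𝓝[>] 0) (𝓝 (φ t)) := fun t =>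
    (hcw.tendsto (x₀ t)).comp (hconv t)
  filter_upwards [hc, (hlim e).eventually_const_lt hp, (hlim (-e)).eventually_lt_const hn]
    with ε h1 h2 h3
  obtain ⟨d, hd, hd0⟩ := intermediate_value_Icc (by linarith : -e ≤ e)
    (hcw.comp h1).continuousOn ⟨h3.le, h2.le⟩
  exact ⟨d, (abs_le.2 ⟨hd.1, hd.2⟩).trans (min_le_right _ _), hd0⟩

/-! ### Uniform remainder, domination and convergence of distances -/

/-- A `C¹` map is differentiable uniformly at the points of a compact set. -/
lemma IsCompact.exists_forall_norm_sub_sub_fderiv_le {E F : Type*} [NormedAddCommGroup E]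
    [NormedSpace ℝ E] [NormedAddCommGroup F] [NormedSpace ℝ F] {f : E → F} (hf : ContDiff ℝ 1 f)
    {K : Set E} (hK : IsCompact K) {η : ℝ} (hη : 0 < η) :
    ∃ δ > 0, ∀ ξ ∈ K, ∀ ζ, ‖ζ - ξ‖ < δ → ‖f ζ - f ξ - fderiv ℝ f ξ (ζ - ξ)‖ ≤ η * ‖ζ - ξ‖ := by
  have h := hK.uniformContinuousAt_of_continuousAt (fderiv ℝ f)
    (fun a _ => (hf.continuous_fderiv one_ne_zero).continuousAt) (Metric.dist_mem_uniformity hη)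
  obtain ⟨δ, hδ, H⟩ := Metric.mem_uniformity_dist.1 h
  refine ⟨δ, hδ, fun ξ hξ ζ hζ => ?_⟩
  refine (convex_ball ξ δ).norm_image_sub_le_of_norm_fderiv_le'
    (fun u _ => hf.differentiable one_ne_zero u) (fun u hu => ?_) (Metric.mem_ball_self hδ)
    (by rwa [Metric.mem_ball, dist_eq_norm])
  have := H (a := ξ) (b := u) (by rwa [dist_comm]) hξ
  rw [← dist_eq_norm, dist_comm]
  exact le_of_lt this

lemma IsLocallyDominated.exists_bound {g : ℝ → Plane → ℝ → Set Plane} (hg : IsLocallyDominated g)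
    {B : Set Plane} (hB : Bornology.IsBounded B) {K : Set ℝ} (hK : IsCompact K) :
    ∃ C ≥ 0, ∀ᵐ t, t ∈ K → ∀ x ∈ B, ∀ ε ∈ Icc (0 : ℝ) 1, ∀ v ∈ g t x ε, ‖v‖ ≤ C := by
  obtain ⟨μ, hμ, hgμ⟩ := hg B hB
  have h := ae_le_eLpNormEssSup (f := μ) (μ := volume.restrict K)
  have hfin : eLpNormEssSup μ (volume.restrict K) < ⊤ := by
    simpa using (hμ K hK).2
  refine ⟨(eLpNormEssSup μ (volume.restrict K)).toReal, ENNReal.toReal_nonneg, ?_⟩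
  rw [ae_restrict_iff' hK.measurableSet] at h
  filter_upwards [h] with t ht htK x hx ε hε v hv
  refine (hgμ t x hx ε hε v hv).trans ((le_abs_self _).trans ?_)
  rw [← Real.norm_eq_abs, ← toReal_enorm]
  exact ENNReal.toReal_mono hfin.ne (ht htK)

/-- The null set where membership fails depends on `ε`, so a.e. convergence is not immediate.
Setting the integrand to zero there gives convergence at every point, and dominated convergence
applies. -/
lemma tendsto_integral_infDist {μ : Measure ℝ} [IsFiniteMeasure μ] {l : Filter ℝ}
    [l.IsCountablyGenerated] {w : ℝ → ℝ → Plane} {S : ℝ → ℝ → Set Plane} {G : ℝ → Set Plane}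
    {D : ℝ}
    (hmeas : ∀ᶠ ε in l, Measurable fun s => Metric.infDist (w ε s) (G s))
    (hmem : ∀ᶠ ε in l, ∀ᵐ s ∂μ, w ε s ∈ S ε s)
    (hS : ∀ s, ∀ η > 0, ∀ᶠ ε in l, ∀ v ∈ S ε s, Metric.infDist v (G s) < η)
    (hbound : ∀ᶠ ε in l, ∀ᵐ s ∂μ, Metric.infDist (w ε s) (G s) ≤ D) :
    Tendsto (fun ε => ∫ s, Metric.infDist (w ε s) (G s) ∂μ) l (𝓝 0) := by
  classical
  set F : ℝ → ℝ → ℝ := fun ε s => if w ε s ∈ S ε s then Metric.infDist (w ε s) (G s) else 0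
  have hF : ∀ᶠ ε in l, (fun s => Metric.infDist (w ε s) (G s)) =ᵐ[μ] F ε := by
    filter_upwards [hmem] with ε hε
    filter_upwards [hε] with s hs
    simp only [F, if_pos hs]
  have hlim : Tendsto (fun ε => ∫ s, F ε s ∂μ) l (𝓝 (∫ _, (0 : ℝ) ∂μ)) := by
    refine tendsto_integral_filter_of_dominated_convergence (fun _ => D) ?_ ?_
      (integrable_const D) ?_
    · filter_upwards [hF, hmeas] with ε hε hm
      exact hm.aestronglyMeasurable.congr hε
    · filter_upwards [hF, hbound] with ε hε hb
      filter_upwards [hε, hb] with s hs hbs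
      rw [← hs, Real.norm_of_nonneg Metric.infDist_nonneg]
      exact hbs
    · refine ae_of_all _ fun s => ?_
      rw [Metric.tendsto_nhds]
      intro η hη
      filter_upwards [hS s η hη] with ε hε
      rw [dist_zero_right]
      by_cases h : w ε s ∈ S ε s
      · simp only [F, if_pos h, Real.norm_of_nonneg Metric.infDist_nonneg]
        exact hε _ h
      · simpa only [F, if_neg h, norm_zero] using hη
  rw [integral_zero] at hlim
  refine hlim.congr' ?_
  filter_upwards [hF] with ε hε
  exact (integral_congr_ae hε).symm

/-! ### Periodic solutions of the forced linear system -/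

section Return

variable {f : Plane → Plane} {x₀ p y z ρ : ℝ → Plane} {T c : ℝ}

/-- A periodic solution of the forced linear system feels the forcing through the shear. -/
lemma shear_mul_wedge_eq_integral (hf : ContDiff ℝ 1 f) (hs : IsSymmetricField f)
    (hx₀ : Continuous x₀) (hy : IsLinearizedSolution f x₀ y)
    (hpT : Function.Periodic p T) (hyT : ∀ t, y (t + T) = y t + c • p t)
    (hz : ∀ a b, AbsolutelyContinuousOnInterval z a b) (hzT : Function.Periodic z T)
    (hzd : ∀ᵐ t, HasDerivAt z (fderiv ℝ f (x₀ t) (z t) + ρ t) t) (t : ℝ) :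
    c * wedge (p t) (z t) = ∫ s in (t - T)..t, wedge (y s) (ρ s) := by
  rw [← hy.wedge_sub_eq_integral hf hs hx₀ (hz _ _) hzd]
  have h1 := hyT (t - T)
  have h2 := hpT (t - T)
  have h3 := hzT (t - T)
  rw [sub_add_cancel] at h1 h2 h3
  rw [h1, h3, ← h2, ← wedge_sub_left, add_sub_cancel_left, wedge_smul_left]

lemma norm_integral_wedge_le {a b Y R : ℝ} {K : Set ℝ} (hK : uIoc a b ⊆ K)
    (hY : ∀ t ∈ K, ‖y t‖ ≤ Y)
    (hY0 : 0 ≤ Y) (hR : ∀ᵐ t, t ∈ K → ‖ρ t‖ ≤ R) :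
    |∫ s in a..b, wedge (y s) (ρ s)| ≤ Y * R * |b - a| := by
  rw [← Real.norm_eq_abs]
  refine intervalIntegral.norm_integral_le_of_norm_le_const_ae ?_
  filter_upwards [hR] with t ht htab
  exact (abs_wedge_le _ _).trans (mul_le_mul (hY t (hK htab)) (ht (hK htab)) (norm_nonneg _) hY0)

/-- The shear identity bounds `wedge p z`; the phase condition and the Lagrange identity from `0` to
`t` bound `wedge z y`. Cramer's rule combines them. All integration windows with `t ∈ [0, T)` lie in
`[-T, T]`. -/
lemma norm_le_of_forced_linearized (hf : ContDiff ℝ 1 f) (hs : IsSymmetricField f)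
    (hx₀ : Continuous x₀) (hT : 0 < T) (hp : IsLinearizedSolution f x₀ p)
    (hy : IsLinearizedSolution f x₀ y) (hpT : Function.Periodic p T) (hc : c ≠ 0)
    (hyT : ∀ t, y (t + T) = y t + c • p t)
    (hz : ∀ a b, AbsolutelyContinuousOnInterval z a b) (hzT : Function.Periodic z T)
    (hzd : ∀ᵐ t, HasDerivAt z (fderiv ℝ f (x₀ t) (z t) + ρ t) t)
    (hz0 : wedge (z 0) (y 0) = 0) (hN : 0 < wedge (p 0) (y 0)) {P Y R : ℝ}
    (hP : ∀ t, ‖p t‖ ≤ P) (hY : ∀ t ∈ Icc (-T) T, ‖y t‖ ≤ Y) (hY0 : 0 ≤ Y)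
    (hR : ∀ᵐ t, t ∈ Icc (-T) T → ‖ρ t‖ ≤ R) (hR0 : 0 ≤ R) (t : ℝ) :
    ‖z t‖ ≤ (wedge (p 0) (y 0))⁻¹ * (P + |c|⁻¹ * Y) * (Y * T) * R := by
  obtain ⟨t', ht', hzt'⟩ := hzT.exists_mem_Ico₀ hT t
  rw [hzt']
  clear hzt' t
  rename' t' => t, ht' => ht
  have h1 : |wedge (p t) (z t)| ≤ |c|⁻¹ * (Y * R * T) := by
    rw [le_inv_mul_iff₀ (abs_pos.2 hc), ← abs_mul,
      shear_mul_wedge_eq_integral hf hs hx₀ hy hpT hyT hz hzT hzd]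
    have := norm_integral_wedge_le (a := t - T) (b := t) (K := Icc (-T) T)
      (by rw [uIoc_of_le (by linarith)]; intro s hs; exact ⟨by linarith [hs.1, ht.1],
        by linarith [hs.2, ht.2]⟩) hY hY0 hR
    rwa [sub_sub_cancel, abs_of_pos hT] at this
  have h2 : |wedge (z t) (y t)| ≤ Y * R * T := by
    have h3 := hy.wedge_sub_eq_integral hf hs hx₀ (hz 0 t) hzd
    rw [wedge_swap (y 0), hz0, neg_zero, sub_zero] at h3
    rw [wedge_swap, abs_neg, h3]
    refine (norm_integral_wedge_le (K := Icc (-T) T) ?_ hY hY0 hR).trans ?_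
    · rw [uIoc_of_le ht.1]
      intro s hs; exact ⟨by linarith [hs.1], by linarith [hs.2, ht.2]⟩
    · rw [sub_zero, abs_of_nonneg ht.1]
      have := ht.2.le
      gcongr
  have h4 : z t = (wedge (p 0) (y 0))⁻¹ • (wedge (z t) (y t) • p t + wedge (p t) (z t) • y t) := by
    rw [eq_inv_smul_iff₀ hN.ne', hp.wedge_eq hy hs (hf.differentiable one_ne_zero) 0 t]
    exact wedge_cramer _ _ _
  have hyt := hY t ⟨by linarith [ht.1], ht.2.le⟩
  calc ‖z t‖ = (wedge (p 0) (y 0))⁻¹ * ‖wedge (z t) (y t) • p t + wedge (p t) (z t) • y t‖ := by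
        conv_lhs => rw [h4]
        rw [norm_smul, Real.norm_of_nonneg (inv_nonneg.2 hN.le)]
    _ ≤ (wedge (p 0) (y 0))⁻¹ * (Y * R * T * P + |c|⁻¹ * (Y * R * T) * Y) := by
        refine mul_le_mul_of_nonneg_left ((norm_add_le _ _).trans ?_) (inv_nonneg.2 hN.le)
        rw [norm_smul, norm_smul]
        exact add_le_add
          (mul_le_mul h2 (hP t) (norm_nonneg _) (by positivity))
          (mul_le_mul h1 hyt (norm_nonneg _) (by positivity))
    _ = _ := by ring

end Return

/-! ### Perturbed solutions along the cycle -/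

lemma Measurable.wedge {X : Type*} [MeasurableSpace X] {u v : X → Plane} (hu : Measurable u)
    (hv : Measurable v) : Measurable fun t => wedge (u t) (v t) := by
  unfold _root_.wedge
  fun_prop

lemma integrableOn_wedge {y ρ : ℝ → Plane} {Y R : ℝ} {K : Set ℝ} (hK : IsCompact K)
    (hym : Measurable y) (hρm : Measurable ρ) (hY : ∀ t ∈ K, ‖y t‖ ≤ Y) (hY0 : 0 ≤ Y)
    (hR : ∀ᵐ t, t ∈ K → ‖ρ t‖ ≤ R) : IntegrableOn (fun t => wedge (y t) (ρ t)) K := by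
  refine Measure.integrableOn_of_bounded (M := Y * R) hK.measure_lt_top.ne
    (hym.wedge hρm).aestronglyMeasurable ?_
  rw [ae_restrict_iff' hK.measurableSet]
  filter_upwards [hR] with t ht htK
  exact (abs_wedge_le _ _).trans (mul_le_mul (hY t htK) (ht htK) (norm_nonneg _) hY0)

lemma IsInclusionSolution.continuous {f : Plane → Plane} {g : ℝ → Plane → ℝ → Set Plane} {ε : ℝ}
    {u : ℝ → Plane} (hu : IsInclusionSolution f g ε u) : Continuous u := by
  refine continuous_iff_continuousAt.2 fun t => ?_
  refine (hu.absolutelyContinuous (t - 1) (t + 1)).continuousOn.continuousAt ?_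
  rw [uIcc_of_le (by linarith)]
  exact Icc_mem_nhds (by linarith) (by linarith)

/-- Solving the inclusion for its selection gives an explicit `w`, so no measurable choice is
needed. -/
lemma IsInclusionSolution.shift_sub {f : Plane → Plane} {g : ℝ → Plane → ℝ → Set Plane} {ε : ℝ}
    {u x₀ : ℝ → Plane} (hu : IsInclusionSolution f g ε u) (hε : ε ≠ 0)
    (hx₀ : ∀ t, HasDerivAt x₀ (f (x₀ t)) t) (d : ℝ) {w : ℝ → Plane}
    (hw : w = fun s => ε⁻¹ • (deriv u (s + d) - f (u (s + d)))) :
    ∀ᵐ s, w s ∈ g (s + d) (u (s + d)) ε ∧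
      HasDerivAt (fun t => u (t + d) - x₀ t) (f (u (s + d)) + ε • w s - f (x₀ s)) s := by
  have h := (measurePreserving_add_right volume d).quasiMeasurePreserving.ae hu.inclusion
  filter_upwards [h] with s ⟨v, hv, hd⟩
  have hwv : w s = v := by
    rw [hw]
    simp only [hd.deriv, add_sub_cancel_left, smul_smul, inv_mul_cancel₀ hε, one_smul]
  rw [hwv]
  exact ⟨hv, (hd.comp_add_const s d).fun_sub (hx₀ s)⟩

lemma IsCycle.eventually_norm_shift_sub_lt {f : Plane → Plane} {T : ℝ} {x₀ : ℝ → Plane}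
    (hx₀ : IsCycle f T x₀) (hT : 0 < T) {l : Filter ℝ} {x : ℝ → ℝ → Plane}
    (hx : ∀ᶠ ε in l, Function.Periodic (x ε) T) (hconv : TendstoUniformlyOn x x₀ l (Icc 0 T))
    {Δ : ℝ → ℝ} (hΔ : Tendsto Δ l (𝓝 0)) {P : ℝ} (hP : ∀ t, ‖deriv x₀ t‖ ≤ P) {η : ℝ}
    (hη : 0 < η) : ∀ᶠ ε in l, ∀ t, ‖x ε (t + Δ ε) - x₀ t‖ < η := by
  have hΔP : Tendsto (fun ε => P * ‖Δ ε‖) l (𝓝 0) := by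
    simpa using hΔ.norm.const_mul P
  filter_upwards [hx, Metric.tendstoUniformlyOn_iff.1 hconv (η / 2) (by positivity),
    hΔP.eventually_lt_const (by positivity : 0 < η / 2)] with ε hper hc hd t
  have h1 : ∀ s, ‖x ε s - x₀ s‖ < η / 2 := by
    intro s
    have hq : Function.Periodic (fun s => x ε s - x₀ s) T := hper.sub hx₀.periodic
    obtain ⟨s', hs', he⟩ := hq.exists_mem_Ico₀ hT s
    rw [he, ← dist_eq_norm, dist_comm]
    exact hc s' ⟨hs'.1, hs'.2.le⟩
  have h2 : ‖x₀ (t + Δ ε) - x₀ t‖ ≤ P * ‖Δ ε‖ := by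
    have := convex_univ.norm_image_sub_le_of_norm_deriv_le (f := x₀)
      (fun s _ => (hx₀.hasDerivAt s).differentiableAt) (fun s _ => hP s) (mem_univ t)
      (mem_univ (t + Δ ε))
    rwa [add_sub_cancel_left] at this
  calc ‖x ε (t + Δ ε) - x₀ t‖
      = ‖(x ε (t + Δ ε) - x₀ (t + Δ ε)) + (x₀ (t + Δ ε) - x₀ t)‖ := by rw [sub_add_sub_cancel]
    _ ≤ _ := norm_add_le _ _
    _ < η := by linarith [h1 (t + Δ ε)]

lemma IsUSCPerturbation.upperHemicontinuousOn_section {g : ℝ → Plane → ℝ → Set Plane}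
    (hg : IsUSCPerturbation g) {x₀ : ℝ → Plane} (hx₀ : Continuous x₀) :
    UpperHemicontinuousOn (fun s => g s (x₀ s) 0) univ := by
  have hm : MapsTo (fun s : ℝ => ((s, x₀ s, 0) : ℝ × Plane × ℝ)) univ
      {p | p.2.2 ∈ Icc (0 : ℝ) 1} := fun s _ => ⟨le_rfl, zero_le_one⟩
  exact hg.usc.comp (by fun_prop) hm

lemma IsUSCPerturbation.eventually_infDist_lt {g : ℝ → Plane → ℝ → Set Plane}
    (hg : IsUSCPerturbation g) {a : ℝ → ℝ} {u : ℝ → Plane} {s : ℝ} {v : Plane}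
    (ha : Tendsto a (𝓝[>] 0) (𝓝 s)) (hu : Tendsto u (𝓝[>] 0) (𝓝 v)) {η : ℝ} (hη : 0 < η) :
    ∀ᶠ ε in 𝓝[>] (0 : ℝ), ∀ q ∈ g (a ε) (u ε) ε, Metric.infDist q (g s v 0) < η := by
  have h := hg.usc.eventually_infDist_lt (p := (s, v, 0)) ⟨le_rfl, zero_le_one⟩
    (hg.nonempty s v 0 ⟨le_rfl, zero_le_one⟩) hη
  refine (tendsto_nhdsWithin_iff.2 ⟨ha.prodMk_nhds (hu.prodMk_nhds
    (tendsto_id.mono_left nhdsWithin_le_nhds)), ?_⟩ : Tendsto (fun ε => (a ε, u ε, ε)) (𝓝[>] 0)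
      (𝓝[{p : ℝ × Plane × ℝ | p.2.2 ∈ Icc (0 : ℝ) 1}] (s, v, 0))).eventually h
  filter_upwards [self_mem_nhdsWithin, nhdsWithin_le_nhds (Iio_mem_nhds one_pos)] with ε h1 h2
  exact ⟨le_of_lt h1, le_of_lt h2⟩

/-! ### The asymptotic expansion -/

theorem theorem4 (f : Plane → Plane) (hf : ContDiff ℝ 1 f)
    (hham : IsHamiltonianField f) (hsymm : IsSymmetricField f)
    (g : ℝ → Plane → ℝ → Set Plane) (hg : IsUSCPerturbation g) (hH : IsLocallyDominated g)
    (T : ℝ) (hT : 0 < T) (x₀ : ℝ → Plane) (hx₀ : IsCycle f T x₀)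
    (hnondeg : IsNondegenerate f T x₀)
    (ε₁ : ℝ) (hε₁ : ε₁ ∈ Ioc (0 : ℝ) 1) (x : ℝ → ℝ → Plane)
    (hx : ∀ ε ∈ Ioc (0 : ℝ) ε₁, IsInclusionSolution f g ε (x ε) ∧ Function.Periodic (x ε) T)
    (hconv : TendstoUniformlyOn x x₀ (𝓝[>] (0 : ℝ)) (Icc 0 T))
    (y : ℝ → Plane) (hy : IsLinearizedSolution f x₀ y)
    (hy0 : y 0 = !₂[-(deriv x₀ 0 1), deriv x₀ 0 0])
    (tstar : ℝ) (htstar : tstar ∈ Icc 0 T) (hstar : deriv x₀ tstar 1 = 0) :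
    y tstar 0 - y (T + tstar) 0 ≠ 0 ∧
    ∃ Δ : ℝ → ℝ, Tendsto Δ (𝓝[>] (0 : ℝ)) (𝓝 0) ∧
      ∀ η > (0 : ℝ), ∀ᶠ ε in 𝓝[>] (0 : ℝ), ∀ t ∈ Icc 0 T,
        ∃ m ∈ MPerp g T x₀ y tstar t,
          ‖(x ε (t + Δ ε) - x₀ t) - (‖deriv x₀ 0‖ ^ 2)⁻¹ •
            ((ε * m) • y t +
              inner ℝ (!₂[y t 1, -(y t 0)] : Plane) (x ε (t + Δ ε) - x₀ t) • deriv x₀ t)‖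
            ≤ η * ε := by
  have hfd := hf.differentiable one_ne_zero
  have hx₀c := hx₀.continuous
  have hp := hx₀.linearized_deriv hfd
  have hpT := hx₀.deriv_periodic
  have hp0 := hx₀.deriv_ne_zero hT hf
  have hNeq : wedge (deriv x₀ 0) (y 0) = ‖deriv x₀ 0‖ ^ 2 := by
    rw [hy0, EuclideanSpace.norm_sq_eq]
    simp [wedge]
    ring
  have hN : 0 < wedge (deriv x₀ 0) (y 0) := by
    rw [hNeq]
    exact pow_pos (norm_pos_iff.2 (hp0 0)) 2
  obtain ⟨c, hc, hyT⟩ := hx₀.exists_shear hsymm hfd hnondeg hy hN.ne'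
  have hpstar : deriv x₀ tstar 0 ≠ 0 := by
    intro h
    refine hp0 tstar (PiLp.ext fun i => ?_)
    fin_cases i
    · simpa using h
    · simpa using hstar
  have hdiff : y tstar 0 - y (T + tstar) 0 = -(c * deriv x₀ tstar 0) := by
    rw [add_comm T, hyT]
    simp
  have hcoef : deriv x₀ tstar 0 / (y tstar 0 - y (T + tstar) 0) = -c⁻¹ := by
    rw [hdiff]
    field_simp
  refine ⟨by rw [hdiff]; exact neg_ne_zero.2 (mul_ne_zero hc hpstar), ?_⟩
  have hsmall : ∀ᶠ ε in 𝓝[>] (0 : ℝ), ε ∈ Ioc (0 : ℝ) ε₁ := Ioc_mem_nhdsGT hε₁.1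
  have hperiodic : ∀ᶠ ε in 𝓝[>] (0 : ℝ), Function.Periodic (x ε) T :=
    hsmall.mono fun ε hε => (hx ε hε).2
  obtain ⟨P, hP⟩ : ∃ P, ∀ t, ‖deriv x₀ t‖ ≤ P := by
    obtain ⟨P, hP⟩ := (hpT.isBounded_of_continuous hT.ne' hp.continuous).exists_norm_le
    exact ⟨P, fun t => hP _ (mem_range_self t)⟩
  obtain ⟨X, hX⟩ : ∃ X, ∀ t, ‖x₀ t‖ ≤ X := by
    obtain ⟨X, hX⟩ := (hx₀.periodic.isBounded_of_continuous hT.ne' hx₀c).exists_norm_le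
    exact ⟨X, fun t => hX _ (mem_range_self t)⟩
  obtain ⟨Y, hY⟩ := isCompact_Icc.exists_bound_of_continuousOn
    (hy.continuous.continuousOn (s := Icc (-T) T))
  have hY0 : 0 ≤ Y := (norm_nonneg _).trans (hY 0 ⟨by linarith, hT.le⟩)
  have hP0 : 0 ≤ P := (norm_nonneg _).trans (hP 0)
  obtain ⟨Δ, hΔ, hphase⟩ := exists_phase (x := x) (x₀ := x₀) (b := y 0)
    (hsmall.mono fun ε hε => (hx ε hε).1.continuous)
    (fun t => by
      have hz0 : Tendsto (fun _ : ℝ => (0 : ℝ)) (𝓝[>] 0) (𝓝 0) := tendsto_const_nhds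
      rw [Metric.tendsto_nhds]
      intro η hη
      filter_upwards [hx₀.eventually_norm_shift_sub_lt hT hperiodic hconv hz0 hP hη] with ε hε
      simpa [dist_eq_norm] using hε t)
    (hx₀.hasDerivAt 0).differentiableAt hN
  refine ⟨Δ, hΔ, ?_⟩
  set z : ℝ → ℝ → Plane := fun ε t => x ε (t + Δ ε) - x₀ t with hz
  have hzsmall : ∀ η > 0, ∀ᶠ ε in 𝓝[>] (0 : ℝ), ∀ t, ‖z ε t‖ < η := fun η hη =>
    hx₀.eventually_norm_shift_sub_lt hT hperiodic hconv hΔ hP hη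
  set w : ℝ → ℝ → Plane :=
    fun ε s => ε⁻¹ • (deriv (x ε) (s + Δ ε) - f (x ε (s + Δ ε))) with hw
  set r : ℝ → ℝ → Plane :=
    fun ε s => f (x ε (s + Δ ε)) - f (x₀ s) - fderiv ℝ f (x₀ s) (z ε s) with hr
  set ρ : ℝ → ℝ → Plane := fun ε s => r ε s + ε • w ε s with hρ
  set G : ℝ → Set Plane := fun s => g s (x₀ s) 0 with hG
  have hzero : (0 : ℝ) ∈ Icc (0 : ℝ) 1 := ⟨le_rfl, zero_le_one⟩
  have hGne : ∀ s, (G s).Nonempty := fun s => hg.nonempty s _ 0 hzero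
  have hGc : ∀ s, IsCompact (G s) := fun s => hg.isCompact s _ 0 hzero
  have hGconv : ∀ s, Convex ℝ (G s) := fun s => hg.convex s _ 0 hzero
  have hGusc : UpperHemicontinuousOn G univ := hg.upperHemicontinuousOn_section hx₀c
  -- The margins of `1` in state and time absorb `z` and the shift `Δ ε`.
  obtain ⟨C, hC0, hC⟩ := hH.exists_bound
    (Metric.isBounded_closedBall (x := (0 : Plane)) (r := X + 1))
    (isCompact_Icc (a := -T - 1) (b := T + 1))
  have hGbound : ∀ᵐ s, s ∈ Icc (-T) T → ∀ v ∈ G s, ‖v‖ ≤ C := by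
    filter_upwards [hC] with s hs hsT v hv
    exact hs ⟨by linarith [hsT.1], by linarith [hsT.2]⟩ (x₀ s)
      (by simpa using (hX s).trans (by linarith)) 0 hzero v hv
  have hwmem : ∀ᶠ ε in 𝓝[>] (0 : ℝ), ∀ᵐ s, w ε s ∈ g (s + Δ ε) (x ε (s + Δ ε)) ε := by
    filter_upwards [hsmall] with ε hε
    filter_upwards [(hx ε hε).1.shift_sub hε.1.ne' hx₀.hasDerivAt (Δ ε) rfl] with s hs
    exact hs.1
  have hzd : ∀ᶠ ε in 𝓝[>] (0 : ℝ), ∀ᵐ s,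
      HasDerivAt (z ε) (fderiv ℝ f (x₀ s) (z ε s) + ρ ε s) s := by
    filter_upwards [hsmall] with ε hε
    filter_upwards [(hx ε hε).1.shift_sub hε.1.ne' hx₀.hasDerivAt (Δ ε) rfl] with s hs
    convert! hs.2 using 1
    simp only [hρ, hr, hw]
    abel
  have hwbound : ∀ᶠ ε in 𝓝[>] (0 : ℝ), ∀ᵐ s, s ∈ Icc (-T) T → ‖w ε s‖ ≤ C := by
    have hΔ1 : ∀ᶠ ε in 𝓝[>] (0 : ℝ), |Δ ε| < 1 := by
      simpa using hΔ.abs.eventually_lt_const (by simp : |(0 : ℝ)| < 1)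
    filter_upwards [hwmem, hzsmall 1 one_pos, hsmall, hΔ1] with ε hm hz1 hε hd
    have hCs := (measurePreserving_add_right volume (Δ ε)).quasiMeasurePreserving.ae hC
    rw [abs_lt] at hd
    filter_upwards [hm, hCs] with s hs hCs hsT
    refine hCs ⟨by linarith [hsT.1], by linarith [hsT.2]⟩ _ ?_ ε ⟨hε.1.le, hε.2.trans hε₁.2⟩ _ hs
    rw [mem_closedBall_zero_iff]
    have h1 := hz1 s
    have h2 := norm_add_le (z ε s) (x₀ s)
    rw [hz, sub_add_cancel] at h2
    linarith [hX s]
  have hrsmall : ∀ η > 0, ∀ᶠ ε in 𝓝[>] (0 : ℝ), ∀ s, ‖r ε s‖ ≤ η * ‖z ε s‖ := by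
    intro η hη
    obtain ⟨δ, hδ, H⟩ := (hx₀.periodic.compact_of_continuous hT.ne'
      hx₀c).exists_forall_norm_sub_sub_fderiv_le hf hη
    filter_upwards [hzsmall δ hδ] with ε hε s
    exact H (x₀ s) (mem_range_self s) _ (hε s)
  have hzcont : ∀ᶠ ε in 𝓝[>] (0 : ℝ), Continuous fun s => x ε (s + Δ ε) := by
    filter_upwards [hsmall] with ε hε
    exact (hx ε hε).1.continuous.comp (by fun_prop)
  have hzper : ∀ᶠ ε in 𝓝[>] (0 : ℝ), Function.Periodic (z ε) T := by
    filter_upwards [hperiodic] with ε hε t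
    simp only [hz, hx₀.periodic t, add_right_comm t T, hε (t + Δ ε)]
  have hzac : ∀ᶠ ε in 𝓝[>] (0 : ℝ), ∀ a b, AbsolutelyContinuousOnInterval (z ε) a b := by
    filter_upwards [hsmall] with ε hε a b
    have hx₀1 : ContDiff ℝ 1 x₀ := contDiff_one_iff_deriv.2
      ⟨fun t => (hx₀.hasDerivAt t).differentiableAt, hp.continuous⟩
    exact (AbsolutelyContinuousOnInterval.comp_add_const
      (hx ε hε).1.absolutelyContinuous _ _ _).fun_sub
      hx₀1.contDiffOn.absolutelyContinuousOnInterval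
  -- The a priori estimate is applied at a maximum of `‖z‖`. The factor `1 / (2 * (k + 1))` makes
  -- the remainder contribute at most half that maximum, which is absorbed; hence `L = 2 * k * C`.
  obtain ⟨L, hL0, hL⟩ : ∃ L ≥ 0, ∀ᶠ ε in 𝓝[>] (0 : ℝ), ∀ t, ‖z ε t‖ ≤ L * ε := by
    set k := (wedge (deriv x₀ 0) (y 0))⁻¹ * (P + |c|⁻¹ * Y) * (Y * T) with hk
    have hk0 : 0 ≤ k := by positivity
    refine ⟨2 * k * C, by positivity, ?_⟩
    filter_upwards [hsmall, hzcont, hzper, hzac, hzd, hphase, hwbound,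
      hrsmall (1 / (2 * (k + 1))) (by positivity)] with ε hε hcont hper hac hd hph hwb hrs t
    obtain ⟨t₀, -, ht₀⟩ := (isCompact_Icc (a := 0) (b := T)).exists_isMaxOn
      (nonempty_Icc.2 hT.le) (f := fun t => ‖z ε t‖) (hcont.sub hx₀c).norm.continuousOn
    have hmax : ∀ s, ‖z ε s‖ ≤ ‖z ε t₀‖ := by
      intro s
      obtain ⟨s', hs', he⟩ := hper.exists_mem_Ico₀ hT s
      rw [he]
      exact ht₀ ⟨hs'.1, hs'.2.le⟩
    have hρb : ∀ᵐ s, s ∈ Icc (-T) T → ‖ρ ε s‖ ≤ 1 / (2 * (k + 1)) * ‖z ε t₀‖ + ε * C := by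
      filter_upwards [hwb] with s hs hsT
      refine (norm_add_le _ _).trans (add_le_add ((hrs s).trans ?_) ?_)
      · exact mul_le_mul_of_nonneg_left (hmax s) (by positivity)
      · rw [norm_smul, Real.norm_of_nonneg hε.1.le]
        exact mul_le_mul_of_nonneg_left (hs hsT) hε.1.le
    have hb := norm_le_of_forced_linearized hf hsymm hx₀c hT hp hy hpT hc hyT hac hper hd
      (by simpa [hz] using hph) hN hP hY hY0 hρb
      (add_nonneg (by positivity) (mul_nonneg hε.1.le hC0)) t₀
    rw [← hk] at hb
    have h2 : k * (1 / (2 * (k + 1)) * ‖z ε t₀‖) ≤ ‖z ε t₀‖ / 2 := by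
      rw [← mul_assoc, mul_one_div, div_mul_eq_mul_div, div_le_div_iff₀ (by positivity) two_pos]
      nlinarith [norm_nonneg (z ε t₀)]
    refine (hmax t).trans ?_
    rw [mul_add] at hb
    linarith
  have hwmeas : ∀ᶠ ε in 𝓝[>] (0 : ℝ), Measurable (w ε) := by
    filter_upwards [hzcont] with ε hcont
    exact (((measurable_deriv (x ε)).comp (measurable_id.add_const (Δ ε))).sub
      (hf.continuous.comp hcont).measurable).const_smul ε⁻¹
  have hρmeas : ∀ᶠ ε in 𝓝[>] (0 : ℝ), Measurable (ρ ε) := by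
    filter_upwards [hzcont, hwmeas] with ε hcont hwm
    refine Measurable.add (Continuous.measurable ?_) (hwm.const_smul ε)
    exact ((hf.continuous.comp hcont).sub (hf.continuous.comp hx₀c)).sub
      (((hf.continuous_fderiv one_ne_zero).comp hx₀c).clm_apply (hcont.sub hx₀c))
  have hinfb : ∀ᶠ ε in 𝓝[>] (0 : ℝ), ∀ᵐ s ∂volume.restrict (Icc (-T) T),
      Metric.infDist (w ε s) (G s) ≤ C + C := by
    filter_upwards [hwbound] with ε hwb
    rw [ae_restrict_iff' measurableSet_Icc]
    filter_upwards [hwb, hGbound] with s hs hGs hsT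
    obtain ⟨v, hv⟩ := hGne s
    refine (Metric.infDist_le_dist_of_mem hv).trans ?_
    rw [dist_eq_norm]
    exact (norm_sub_le _ _).trans (add_le_add (hs hsT) (hGs hsT v hv))
  have hinfm : ∀ᶠ ε in 𝓝[>] (0 : ℝ), Measurable fun s => Metric.infDist (w ε s) (G s) :=
    hwmeas.mono fun ε hwm => measurable_infDist_of_upperHemicontinuousOn hGne hGc hGusc hwm
  have hinf : Tendsto (fun ε => ∫ s in Icc (-T) T, Metric.infDist (w ε s) (G s)) (𝓝[>] 0)
      (𝓝 0) := by
    refine tendsto_integral_infDist (S := fun ε s => g (s + Δ ε) (x ε (s + Δ ε)) ε) hinfm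
      (hwmem.mono fun ε hε => ae_restrict_of_ae hε) (fun s η hη => ?_) hinfb
    refine hg.eventually_infDist_lt (by simpa using hΔ.const_add s) ?_ hη
    rw [Metric.tendsto_nhds]
    intro δ hδ
    filter_upwards [hzsmall δ hδ] with ε hε
    simpa [dist_eq_norm] using hε s
  intro η hη
  set N := wedge (deriv x₀ 0) (y 0) with hNdef
  set M := N⁻¹ * (|c|⁻¹ * (Y * (L * T + 1))) * Y with hM
  have hM0 : 0 ≤ M := by positivity
  set η' := η / (M + 1) with hη'
  have hη'0 : 0 < η' := by positivity
  filter_upwards [hsmall, hzper, hzac, hzd, hwbound, hL, hwmeas, hρmeas, hinfb, hinfm,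
    hrsmall η' hη'0, hinf.eventually_lt_const hη'0]
    with ε hε hper hac hd hwb hLε hwm hρm hib him hrs hint t ht
  -- The selection depends on `ε` but not on `t`.
  obtain ⟨h, hhm, hh⟩ := exists_measurable_nearest_selection hGne hGc hGconv hGusc hwm
  have hhb : ∀ᵐ s, s ∈ Icc (-T) T → ‖h s‖ ≤ C := by
    filter_upwards [hGbound] with s hs hsT
    exact hs hsT _ (hh s).1
  have hε0 := hε.1
  have hsub : Ioc (t - T) t ⊆ Icc (-T) T := fun s hs =>
    ⟨by linarith [hs.1, ht.1], hs.2.trans ht.2⟩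
  have htT : t - T ≤ t := by linarith
  have hrb : ∀ s, ‖r ε s‖ ≤ η' * (L * ε) := fun s =>
    (hrs s).trans (mul_le_mul_of_nonneg_left (hLε s) hη'0.le)
  set I := ∫ s in (t - T)..t, wedge (y s) (h s) with hI
  have hmain : |c * (wedge (deriv x₀ t) (z ε t) - ε * (c⁻¹ * I))| ≤
      Y * (L * T + 1) * η' * ε := by
    have hρb : ∀ᵐ s, s ∈ Icc (-T) T → ‖ρ ε s‖ ≤ η' * (L * ε) + ε * C := by
      filter_upwards [hwb] with s hs hsT
      refine (norm_add_le _ _).trans (add_le_add (hrb s) ?_)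
      rw [norm_smul, Real.norm_of_nonneg hε0.le]
      exact mul_le_mul_of_nonneg_left (hs hsT) hε0.le
    have hi1 : IntervalIntegrable (fun s => wedge (y s) (ρ ε s)) volume (t - T) t :=
      (intervalIntegrable_iff_integrableOn_Ioc_of_le htT).2 <|
        (integrableOn_wedge isCompact_Icc hy.continuous.measurable hρm hY hY0 hρb).mono_set hsub
    have hi2 : IntervalIntegrable (fun s => wedge (y s) (h s)) volume (t - T) t :=
      (intervalIntegrable_iff_integrableOn_Ioc_of_le htT).2 <|
        (integrableOn_wedge isCompact_Icc hy.continuous.measurable hhm hY hY0 hhb).mono_set hsub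
    have hi3 : IntegrableOn (fun s => Metric.infDist (w ε s) (G s)) (Icc (-T) T) := by
      refine Measure.integrableOn_of_bounded (M := C + C) isCompact_Icc.measure_lt_top.ne
        him.aestronglyMeasurable ?_
      filter_upwards [hib] with s hs
      rwa [Real.norm_of_nonneg Metric.infDist_nonneg]
    have hi3' : IntervalIntegrable (fun s => Metric.infDist (w ε s) (G s)) volume (t - T) t :=
      (intervalIntegrable_iff_integrableOn_Ioc_of_le htT).2 (hi3.mono_set hsub)
    have heq : c * (wedge (deriv x₀ t) (z ε t) - ε * (c⁻¹ * I)) =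
        ∫ s in (t - T)..t, wedge (y s) (ρ ε s - ε • h s) := by
      simp only [wedge_sub_right, wedge_smul_right]
      rw [intervalIntegral.integral_sub hi1 (hi2.const_mul ε), intervalIntegral.integral_const_mul,
        ← shear_mul_wedge_eq_integral hf hsymm hx₀c hy hpT hyT hac hper hd, ← hI]
      field_simp
    rw [heq, ← Real.norm_eq_abs]
    have hle : ‖∫ s in (t - T)..t, wedge (y s) (ρ ε s - ε • h s)‖ ≤
        ∫ s in (t - T)..t, (Y * (η' * (L * ε)) + Y * ε * Metric.infDist (w ε s) (G s)) := by
      refine intervalIntegral.norm_integral_le_of_norm_le htT (ae_of_all _ fun s hs => ?_)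
        (intervalIntegrable_const.add (hi3'.const_mul _))
      have h1 : ‖ρ ε s - ε • h s‖ ≤ η' * (L * ε) + ε * Metric.infDist (w ε s) (G s) := by
        rw [hρ, add_sub_assoc, ← smul_sub]
        refine (norm_add_le _ _).trans (add_le_add (hrb s) ?_)
        rw [norm_smul, Real.norm_of_nonneg hε0.le, (hh s).2]
      refine (abs_wedge_le _ _).trans
        ((mul_le_mul (hY s (hsub hs)) h1 (norm_nonneg _) hY0).trans_eq ?_)
      ring
    refine hle.trans ?_
    rw [intervalIntegral.integral_add intervalIntegrable_const (hi3'.const_mul _),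
      intervalIntegral.integral_const, intervalIntegral.integral_const_mul,
      intervalIntegral.integral_of_le htT, smul_eq_mul, sub_sub_cancel]
    -- Enlarging the window to `[-T, T]` makes the bound uniform in `t`.
    have h2 : ∫ s in Ioc (t - T) t, Metric.infDist (w ε s) (G s) ≤ η' :=
      (setIntegral_mono_set hi3 (ae_of_all _ fun _ => Metric.infDist_nonneg)
        hsub.eventuallyLE).trans hint.le
    have h3 := mul_le_mul_of_nonneg_left h2 (mul_nonneg hY0 hε0.le)
    linarith
  refine ⟨c⁻¹ * I, ⟨h, ⟨hhm.aestronglyMeasurable, ?_⟩, ae_of_all _ fun s => (hh s).1, ?_⟩, ?_⟩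
  · refine (memLp_top_of_bound (C := C) hhm.aestronglyMeasurable ?_).2
    rwa [ae_restrict_iff' measurableSet_Icc]
  · rw [hcoef, hI, neg_mul, ← mul_neg, ← intervalIntegral.integral_neg]
    congr 2
    ext s
    rw [Matrix.det_fin_two_of, wedge]
    ring
  · have hinner : inner ℝ (!₂[y t 1, -(y t 0)] : Plane) (z ε t) = wedge (z ε t) (y t) := by
      rw [PiLp.inner_apply]
      simp [wedge]
      ring
    -- The tangential terms cancel exactly, leaving an error along `y t` alone.
    have hdec : z ε t - (‖deriv x₀ 0‖ ^ 2)⁻¹ • ((ε * (c⁻¹ * I)) • y t +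
        inner ℝ (!₂[y t 1, -(y t 0)] : Plane) (z ε t) • deriv x₀ t) =
        (N⁻¹ * (wedge (deriv x₀ t) (z ε t) - ε * (c⁻¹ * I))) • y t := by
      have hcr := wedge_cramer (deriv x₀ t) (y t) (z ε t)
      rw [hp.wedge_eq hy hsymm hfd t 0, ← hNdef, ← eq_inv_smul_iff₀ hN.ne'] at hcr
      rw [hinner, ← hNeq]
      refine sub_eq_iff_eq_add.2 (hcr.trans ?_)
      module
    change ‖z ε t - (‖deriv x₀ 0‖ ^ 2)⁻¹ • ((ε * (c⁻¹ * I)) • y t +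
        inner ℝ (!₂[y t 1, -(y t 0)] : Plane) (z ε t) • deriv x₀ t)‖ ≤ η * ε
    rw [hdec, norm_smul, norm_mul, Real.norm_of_nonneg (inv_nonneg.2 hN.le), Real.norm_eq_abs]
    rw [abs_mul, ← le_inv_mul_iff₀ (abs_pos.2 hc)] at hmain
    have hyt := hY t ⟨by linarith [ht.1], ht.2⟩
    calc _ ≤ N⁻¹ * (|c|⁻¹ * (Y * (L * T + 1) * η' * ε)) * Y := by gcongr
      _ = M * η' * ε := by rw [hM]; ring
      _ ≤ η * ε := by
        refine mul_le_mul_of_nonneg_right ?_ hε0.le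
        rw [hη', mul_div_assoc', div_le_iff₀ (by positivity)]
        nlinarith
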